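/- Let $N$ be a finite set of players, let $i\in N$, let $S_j$ be a separable metric space for each $j\in N$, and let $\Delta(S)$ be the set of Borel probability measures (lotteries) on $S=\prod_{j\in N}S_j$, with the topology of weak convergence. Let $\succeq_i$ be a binary relation on $\Delta(S)$ that is complete, transitive, continuous (for every $p\in\Delta(S)$ the sets $\{q: q\succeq_i p\}$ and $\{q: p\succeq_i q\}$ are closed) and satisfies independence: for all $p,q,r\in\Delta(S)$ and all $\lambda\in(0,1]$, $p\succeq_i q$ if and only if $\lambda p+(1-\lambda)r\succeq_i\lambda q+(1-\lambda)r$. Write $p\sim_i q$ if $p\succeq_i q$ and $q\succeq_i p$, and write $p_J$ for the marginal of $p$ on $\prod_{j\in J}S_j$. A continuous function $u:S\to\mathbb{R}$ is a Bernoulli index for $\succeq_i$ if $\int u\,dp$ exists and is finite for every $p\in\Delta(S)$ and, for all $p,q\in\Delta(S)$, $p\succeq_i q$ if and only if $\int u\,dp\ge\int u\,dq$. Then the following two conditions are equivalent: (a) there are continuous functions $u_{ij}:S_i\times S_j\to\mathbb{R}$, one for each $j\in N\setminus\{i\}$, such that $s\mapsto\sum_{j\ne i}u_{ij}(s_i,s_j)$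 is a Bernoulli index for $\succeq_i$; (b) for all $p,q\in\Delta(S)$ such that $p_{\{i,j\}}=q_{\{i,j\}}$ for every $j\in N\setminus\{i\}$, we have $p\sim_i q$. -/

import Mathlib

open MeasureTheory

/-- On a finite product of separable metric spaces the product σ-algebra is the Borel σ-algebra. -/
instance profileBorelSpace {N : Type*} [Finite N] {S : N → Type*} [∀ j, MetricSpace (S j)]
    [∀ j, TopologicalSpace.SeparableSpace (S j)] [∀ j, MeasurableSpace (S j)]
    [∀ j, BorelSpace (S j)] : BorelSpace (∀ j, S j) := by
  have : ∀ j, SecondCountableTopology (S j) := fun j =>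
    UniformSpace.secondCountable_of_separable (S j)
  exact Pi.borelSpace

noncomputable section

namespace Lottery

section General

variable {Ω : Type*} [MeasurableSpace Ω]

/-- The compound lottery `t p + (1 - t) r`. -/
def mix (t : unitInterval) (p r : ProbabilityMeasure Ω) : ProbabilityMeasure Ω :=
  ⟨ENNReal.ofReal t • (p : Measure Ω) + ENNReal.ofReal (1 - t) • (r : Measure Ω), by
    constructor
    simp [← ENNReal.ofReal_add t.2.1 (sub_nonneg.2 t.2.2)]⟩

/-- Completeness: `pref p q` reads "`p` is weakly preferred to `q`". -/
def IsComplete (pref : ProbabilityMeasure Ω → ProbabilityMeasure Ω → Prop) : Prop :=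
  ∀ p q, pref p q ∨ pref q p

def IsTransitive (pref : ProbabilityMeasure Ω → ProbabilityMeasure Ω → Prop) : Prop :=
  ∀ p q r, pref p q → pref q r → pref p r

/-- Continuity: weak upper and lower contour sets are closed in the topology of weak
convergence. -/
def IsContinuous [TopologicalSpace Ω] [OpensMeasurableSpace Ω]
    (pref : ProbabilityMeasure Ω → ProbabilityMeasure Ω → Prop) : Prop :=
  ∀ p, IsClosed {q | pref q p} ∧ IsClosed {q | pref p q}

/-- The independence axiom. The weight must be positive: at weight `0` the equivalence would
make any two lotteries indifferent. -/
def IsIndependent (pref : ProbabilityMeasure Ω → ProbabilityMeasure Ω → Prop) : Prop :=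
  ∀ (p q r : ProbabilityMeasure Ω) (t : unitInterval), 0 < t →
    (pref p q ↔ pref (mix t p r) (mix t q r))

def Indifferent (pref : ProbabilityMeasure Ω → ProbabilityMeasure Ω → Prop)
    (p q : ProbabilityMeasure Ω) : Prop :=
  pref p q ∧ pref q p

/-- `u` is a (continuous) Bernoulli index representing `pref`: every lottery has a well-defined
finite expected utility, and lotteries are ranked by expected utility. -/
structure IsBernoulliIndex [TopologicalSpace Ω]
    (pref : ProbabilityMeasure Ω → ProbabilityMeasure Ω → Prop) (u : Ω → ℝ) : Prop where
  continuous : Continuous u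
  integrable : ∀ p : ProbabilityMeasure Ω, Integrable u (p : Measure Ω)
  represents : ∀ p q : ProbabilityMeasure Ω,
    pref p q ↔ ∫ s, u s ∂(p : Measure Ω) ≥ ∫ s, u s ∂(q : Measure Ω)

end General

/-- The marginal of `p` on the coordinates in `J`. -/
def marginal {N : Type*} {S : N → Type*} [∀ j, MeasurableSpace (S j)] (J : Set N)
    (p : ProbabilityMeasure (∀ j, S j)) : ProbabilityMeasure (∀ k : J, S k) :=
  p.map (f := fun s (k : J) => s k) (measurable_pi_lambda _ fun k => measurable_pi_apply k.1).aemeasurable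

end Lottery

end

noncomputable section

namespace Lottery

open Filter Topology unitInterval

/-! ### Compound lotteries and their weak continuity. -/

section Mix

variable {Ω : Type*} [MeasurableSpace Ω]

/-! (b) ⇒ (a): expected utility theory gives an index `u`. Fix a base profile `o` and let `m` be the
number of opponents of `i`. Compare two uniform lotteries on `m` outcomes: one has `s` once and `(s
i, o)` otherwise; the other has, for each opponent `j`, the profile `(s i, s j, o)`. Their `{i, j}`
marginals agree, so (b) yields `u s + (m - 1) u (s i, o) = ∑ j, u (s i, s j, o)`, a pairwise
decomposition (`eq_sum_pairPart`).

(a) ⇒ (b): pair marginals determine the expectation of each pair term, but the given terms may fail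
to be integrable separately. The same decomposition, applied to their sum, replaces them by
integrable ones (`integral_eq`).

The index comes from a continuous affine functional (`exists_affine_representation`), which is an
expectation on finitely supported lotteries, hence on their weak limits. -/

lemma ext_real {p q : ProbabilityMeasure Ω}
    (h : ∀ s, MeasurableSet s → (p : Measure Ω).real s = (q : Measure Ω).real s) : p = q := by
  apply Subtype.ext
  refine Measure.ext fun s hs => ?_
  have := p.2
  have := q.2
  exact (measureReal_eq_measureReal_iff (measure_ne_top _ _) (measure_ne_top _ _)).1 (h s hs)

lemma mix_real (t : I) (p r : ProbabilityMeasure Ω) (s : Set Ω) :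
    (mix t p r : Measure Ω).real s
      = t * (p : Measure Ω).real s + (1 - t) * (r : Measure Ω).real s := by
  have h0 := t.2.1
  have h1 : (0 : ℝ) ≤ 1 - t := sub_nonneg.2 t.2.2
  change (ENNReal.ofReal t • (p : Measure Ω) + ENNReal.ofReal (1 - t) • (r : Measure Ω)).real s = _
  rw [measureReal_add_apply (by simp [ENNReal.mul_eq_top]) (by simp [ENNReal.mul_eq_top]),
    measureReal_ennreal_smul_apply, measureReal_ennreal_smul_apply, ENNReal.toReal_ofReal h0, ENNReal.toReal_ofReal h1]

lemma mix_self (t : I) (p : ProbabilityMeasure Ω) : mix t p p = p :=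
  ext_real fun s _ => by rw [mix_real]; ring

lemma mix_zero (p q : ProbabilityMeasure Ω) : mix 0 p q = q :=
  ext_real fun s _ => by rw [mix_real]; simp

lemma mix_one (p q : ProbabilityMeasure Ω) : mix 1 p q = p :=
  ext_real fun s _ => by rw [mix_real]; simp

lemma mix_comm (t : I) (p q : ProbabilityMeasure Ω) : mix t p q = mix (σ t) q p :=
  ext_real fun s _ => by rw [mix_real, mix_real, coe_symm_eq]; ring

lemma mix_mix_distrib (s t : I) (p q r : ProbabilityMeasure Ω) :
    mix t (mix s p q) r = mix s (mix t p r) (mix t q r) :=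
  ext_real fun s _ => by simp only [mix_real]; ring

/-- The weight of `a` in the compound lottery `s (x a + (1 - x) b) + (1 - s) (y a + (1 - y) b)`. -/
def mixWeight (s x y : I) : I :=
  ⟨s * x + (1 - s) * y, by
    have := mul_nonneg s.2.1 x.2.1
    have := mul_nonneg (sub_nonneg.2 s.2.2) y.2.1
    positivity, by
    nlinarith [mul_nonneg s.2.1 (sub_nonneg.2 x.2.2),
      mul_nonneg (sub_nonneg.2 s.2.2) (sub_nonneg.2 y.2.2)]⟩

lemma mix_mix_mix (s x y : I) (a b : ProbabilityMeasure Ω) :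
    mix s (mix x a b) (mix y a b) = mix (mixWeight s x y) a b :=
  ext_real fun A _ => by simp only [mix_real, mixWeight]; ring

lemma integral_mix {f : Ω → ℝ} (t : I) (p r : ProbabilityMeasure Ω)
    (hp : Integrable f (p : Measure Ω)) (hr : Integrable f (r : Measure Ω)) :
    ∫ x, f x ∂(mix t p r : Measure Ω)
      = t * ∫ x, f x ∂(p : Measure Ω) + (1 - t) * ∫ x, f x ∂(r : Measure Ω) := by
  have h0 := t.2.1
  have h1 : (0 : ℝ) ≤ 1 - t := sub_nonneg.2 t.2.2
  change ∫ x, f x ∂(ENNReal.ofReal t • (p : Measure Ω) + ENNReal.ofReal (1 - t) • (r : Measure Ω))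
    = _
  rw [integral_add_measure (hp.smul_measure (by finiteness)) (hr.smul_measure (by finiteness)),
    integral_smul_measure, integral_smul_measure, ENNReal.toReal_ofReal h0,
    ENNReal.toReal_ofReal h1, smul_eq_mul, smul_eq_mul]

variable [TopologicalSpace Ω] [OpensMeasurableSpace Ω]

lemma continuous_mix :
    Continuous fun x : I × ProbabilityMeasure Ω × ProbabilityMeasure Ω => mix x.1 x.2.1 x.2.2 := by
  refine continuous_iff_continuousAt.2 fun x => ?_
  refine ProbabilityMeasure.tendsto_iff_forall_integral_tendsto.2 fun f => ?_
  simp only [integral_mix _ _ _ (f.integrable _) (f.integrable _)]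
  have hI : Continuous fun p : ProbabilityMeasure Ω => ∫ y, f y ∂(p : Measure Ω) :=
    continuous_iff_continuousAt.2 fun p =>
      ProbabilityMeasure.tendsto_iff_forall_integral_tendsto.1 tendsto_id f
  have : Continuous fun x : I × ProbabilityMeasure Ω × ProbabilityMeasure Ω =>
      (x.1 : ℝ) * ∫ y, f y ∂(x.2.1 : Measure Ω) + (1 - x.1) * ∫ y, f y ∂(x.2.2 : Measure Ω) :=
    ((continuous_subtype_val.comp continuous_fst).mul
      (hI.comp (continuous_fst.comp continuous_snd))).add
      ((continuous_const.sub (continuous_subtype_val.comp continuous_fst)).mul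
      (hI.comp (continuous_snd.comp continuous_snd)))
  exact this.tendsto x

/-- Mixing a small amount of an arbitrary lottery into `c` stays near `c`, uniformly. -/
lemma exists_pos_forall_mix_mem {G : Set (ProbabilityMeasure Ω)} (hG : IsOpen G)
    {c : ProbabilityMeasure Ω} (hc : c ∈ G) : ∃ ε : I, 0 < ε ∧ ∀ p, mix ε p c ∈ G := by
  by_contra! H
  have hpos (n : ℕ) : (0 : ℝ) < 1 / ((n : ℝ) + 1) := by positivity
  let t (n : ℕ) : I := ⟨1 / ((n : ℝ) + 1), (hpos n).le, by
    rw [div_le_one (by positivity)]; linarith [n.cast_nonneg (α := ℝ)]⟩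
  choose p hp using fun n => H (t n) (hpos n)
  have ht : Tendsto (fun n => (t n : ℝ)) atTop (𝓝 0) := tendsto_one_div_add_atTop_nhds_zero_nat
  have hlim : Tendsto (fun n => mix (t n) (p n) c) atTop (𝓝 c) := by
    refine ProbabilityMeasure.tendsto_iff_forall_integral_tendsto.2 fun f => ?_
    simp only [integral_mix _ _ _ (f.integrable _) (f.integrable _)]
    -- Uniformity in the lottery: a bounded test function has expectation at most `‖f‖` under every
    -- `p n`.
    have h1 : Tendsto (fun n => (t n : ℝ) * ∫ y, f y ∂(p n : Measure Ω)) atTop (𝓝 0) :=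
      squeeze_zero_norm (a := fun n => (t n : ℝ) * ‖f‖) (fun n => by
        rw [norm_mul, Real.norm_of_nonneg (t n).2.1]
        exact mul_le_mul_of_nonneg_left (f.norm_integral_le_norm _) (t n).2.1)
        (by simpa using ht.mul_const ‖f‖)
    simpa using h1.add ((ht.const_sub 1).mul_const (∫ y, f y ∂(c : Measure Ω)))
  obtain ⟨n, hn⟩ := (hlim.eventually (hG.mem_nhds hc)).exists
  exact hp n hn

end Mix

/-! ### From independence and continuity to an affine functional. -/

section Preference

variable {Ω : Type*} [MeasurableSpace Ω]
  {pref : ProbabilityMeasure Ω → ProbabilityMeasure Ω → Prop}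

lemma IsIndependent.right (hindep : IsIndependent pref) (p q r : ProbabilityMeasure Ω) {t : I}
    (ht : t < 1) : pref p q ↔ pref (mix t r p) (mix t r q) := by
  rw [mix_comm t r p, mix_comm t r q]
  exact hindep p q r _ (unitInterval.pos_iff_ne_zero.2 fun h => ht.ne (symm_eq_zero.1 h))

lemma pref_mix (htrans : IsTransitive pref) (hindep : IsIndependent pref)
    {p p' q q' : ProbabilityMeasure Ω} (s : I) (hp : pref p p') (hq : pref q q') :
    pref (mix s p q) (mix s p' q') := by
  rcases eq_or_ne s 0 with rfl | h0
  · simpa [mix_zero] using hq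
  rcases eq_or_ne s 1 with rfl | h1
  · simpa [mix_one] using hp
  exact htrans _ _ _ ((hindep _ _ _ _ (unitInterval.pos_iff_ne_zero.2 h0)).1 hp)
    ((hindep.right _ _ _ (lt_of_le_of_ne unitInterval.le_one' h1)).1 hq)

/-- Independence makes `mix t a b` strictly better than `b`; moving from it towards `b` with weight
`s / t` gives `mix s a b`, which is therefore strictly worse. -/
lemma not_pref_mix_of_lt (hindep : IsIndependent pref) {a b : ProbabilityMeasure Ω}
    (hab : ¬ pref b a) {s t : I} (hst : s < t) : ¬ pref (mix s a b) (mix t a b) := by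
  have ht : (0 : ℝ) < t := s.2.1.trans_lt hst
  have h1 : ¬ pref b (mix t a b) := by
    intro h
    apply hab
    rw [hindep b a b t ht, mix_self]
    exact h
  let w : I := ⟨s / t, div_nonneg s.2.1 t.2.1, (div_le_one ht).2 hst.le⟩
  have hw : w < 1 := by
    change (s : ℝ) / t < 1
    exact (div_lt_one ht).2 hst
  rw [hindep.right _ _ (mix t a b) hw, mix_self] at h1
  have hs : mix s a b = mix w (mix t a b) b := ext_real fun A _ => by
    simp only [mix_real, w]
    field_simp
    ring
  rwa [hs]

lemma pref_mix_iff (hcomplete : IsComplete pref) (hindep : IsIndependent pref)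
    {a b : ProbabilityMeasure Ω} (hab : ¬ pref b a) {s t : I} :
    pref (mix s a b) (mix t a b) ↔ t ≤ s := by
  refine ⟨fun h => not_lt.1 fun hst => not_pref_mix_of_lt hindep hab hst h, fun h => ?_⟩
  rcases h.lt_or_eq with h | rfl
  · exact (hcomplete _ _).resolve_right (not_pref_mix_of_lt hindep hab h)
  · exact (hcomplete _ _).elim id id

variable [TopologicalSpace Ω] [OpensMeasurableSpace Ω]

/-- Connectedness of `[0, 1]`: the weights whose mixture is weakly better than `q` and those weakly
worse form two nonempty closed sets covering the interval. -/
lemma exists_indifferent_mix (hcomplete : IsComplete pref) (hcont : IsContinuous pref)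
    {a b q : ProbabilityMeasure Ω} (haq : pref a q) (hqb : pref q b) :
    ∃ t : I, Indifferent pref q (mix t a b) := by
  have hc : Continuous fun t : I => mix t a b :=
    continuous_mix.comp (continuous_id.prodMk (continuous_const (y := (a, b))))
  have := isPreconnected_closed_iff.1 (isPreconnected_univ (α := I)) _ _
    ((hcont q).2.preimage hc) ((hcont q).1.preimage hc) (fun t _ => hcomplete _ _)
    ⟨0, trivial, by simpa [mix_zero] using hqb⟩ ⟨1, trivial, by simpa [mix_one] using haq⟩
  obtain ⟨t, -, h1, h2⟩ := this
  exact ⟨t, h1, h2⟩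

/-- The mixture space theorem: a continuous preference satisfying independence is represented by
a continuous mixture-preserving functional, which weak continuity forces to be bounded. -/
theorem exists_affine_representation (hcomplete : IsComplete pref) (htrans : IsTransitive pref)
    (hcont : IsContinuous pref) (hindep : IsIndependent pref) :
    ∃ φ : ProbabilityMeasure Ω → I, Continuous φ ∧ (∀ p q, pref p q ↔ φ q ≤ φ p) ∧
      ∀ s p q, (φ (mix s p q) : ℝ) = s * φ p + (1 - s) * φ q := by
  by_cases hall : ∀ a b, pref a b
  · exact ⟨fun _ => 0, continuous_const, fun p q => by simp [hall], fun s p q => by simp⟩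
  push Not at hall
  obtain ⟨b, a, hab⟩ := hall
  let half : I := ⟨1 / 2, by norm_num, by norm_num⟩
  let c := mix half a b
  have hca : ¬ pref c a := by
    have := not_pref_mix_of_lt hindep hab (s := half) (t := 1) (by
      change (_ : ℝ) < _; norm_num [half])
    rwa [mix_one] at this
  have hbc : ¬ pref b c := by
    have := not_pref_mix_of_lt hindep hab (s := 0) (t := half) (by
      change (_ : ℝ) < _; norm_num [half])
    rwa [mix_zero] at this
  -- No best or worst lottery need exist. Shrinking every `p` towards `c` with a common weight `ε`
  -- puts it strictly between `b` and `a`, where it can be calibrated against mixtures of the two.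
  obtain ⟨ε, hε, hmem⟩ := exists_pos_forall_mix_mem
    ((hcont a).1.isOpen_compl.inter (hcont b).2.isOpen_compl) (c := c) ⟨hca, hbc⟩
  have hex (p) : ∃ t : I, Indifferent pref (mix ε p c) (mix t a b) :=
    exists_indifferent_mix hcomplete hcont ((hcomplete _ _).resolve_right (hmem p).1)
      ((hcomplete _ _).resolve_right (hmem p).2)
  choose φ hφ using hex
  have hge (p) (t : I) : pref (mix ε p c) (mix t a b) ↔ t ≤ φ p := by
    rw [← pref_mix_iff hcomplete hindep hab]
    exact ⟨htrans _ _ _ (hφ p).2, htrans _ _ _ (hφ p).1⟩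
  have hle (p) (t : I) : pref (mix t a b) (mix ε p c) ↔ φ p ≤ t := by
    rw [← pref_mix_iff hcomplete hindep hab]
    exact ⟨fun h => htrans _ _ _ h (hφ p).1, fun h => htrans _ _ _ h (hφ p).2⟩
  have hT : Continuous fun p : ProbabilityMeasure Ω => mix ε p c :=
    continuous_mix.comp (continuous_const.prodMk (continuous_id.prodMk continuous_const))
  refine ⟨φ, ?_, fun p q => ?_, fun s p q => ?_⟩
  · refine OrderTopology.continuous_iff.2 fun t => ⟨?_, ?_⟩
    · convert ((hcont (mix t a b)).2.preimage hT).isOpen_compl using 1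
      ext p
      simp [hle]
    · convert ((hcont (mix t a b)).1.preimage hT).isOpen_compl using 1
      ext p
      simp [hge]
  · rw [hindep p q c ε hε, ← hge]
    exact ⟨fun h => htrans _ _ _ h (hφ q).1, fun h => htrans _ _ _ h (hφ q).2⟩
  · have : φ (mix s p q) = mixWeight s (φ p) (φ q) := by
      apply le_antisymm
      · rw [← hle, mix_mix_distrib, ← mix_mix_mix]
        exact pref_mix htrans hindep s (hφ p).2 (hφ q).2
      · rw [← hge, mix_mix_distrib, ← mix_mix_mix]
        exact pref_mix htrans hindep s (hφ p).1 (hφ q).1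
    rw [this, mixWeight]

end Preference

/-! ### Affine functionals as expectations. -/

section ExpectedUtility

variable {Ω : Type*} [MeasurableSpace Ω]

/-- A mixture-preserving functional is an expectation on finitely supported lotteries. -/
lemma eq_integral_of_finite_support [MeasurableSingletonClass Ω] {φ : ProbabilityMeasure Ω → ℝ}
    (haff : ∀ (s : I) p q, φ (mix s p q) = s * φ p + (1 - s) * φ q)
    (hint : ∀ p : ProbabilityMeasure Ω, Integrable (fun x => φ (diracProba x)) (p : Measure Ω))
    (F : Finset Ω) : ∀ p : ProbabilityMeasure Ω, (p : Measure Ω) (F : Set Ω)ᶜ = 0 →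
      φ p = ∫ x, φ (diracProba x) ∂(p : Measure Ω) := by
  classical
  induction F using Finset.induction_on with
  | empty => intro p hp; simp at hp
  | insert x F hx ih =>
    intro p hp
    have hxm : MeasurableSet ({x} : Set Ω) := measurableSet_singleton x
    let t : I := ⟨(p : Measure Ω).real {x}, measureReal_nonneg, measureReal_le_one⟩
    have hsplit (s : Set Ω) (hs : MeasurableSet s) : (p : Measure Ω).real s
        = t * (diracProba x : Measure Ω).real s + (p : Measure Ω).real ({x}ᶜ ∩ s) := by
      rw [← measureReal_inter_add_sdiff (s := s) hxm, Set.sdiff_eq, Set.inter_comm s {x}ᶜ]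
      congr 1
      change _ = _ * (Measure.dirac x).real s
      by_cases hxs : x ∈ s
      · simp [hxs, Measure.real, hs, t]
      · simp [hxs, Measure.real, hs]
    have ht : (p : Measure Ω).real {x}ᶜ = 1 - (t : ℝ) := probReal_compl_eq_one_sub hxm
    by_cases h0 : (p : Measure Ω) {x}ᶜ = 0
    · have : p = diracProba x := by
        refine ext_real fun s hs => ?_
        have h1 : (t : ℝ) = 1 := by simp only [Measure.real, h0, ENNReal.toReal_zero] at ht; linarith
        have h2 : (p : Measure Ω).real ({x}ᶜ ∩ s) = 0 := by
          simp [Measure.real, measure_mono_null Set.inter_subset_left h0]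
        rw [hsplit s hs, h1, h2, one_mul, add_zero]
      rw [this]
      change _ = ∫ y, φ (diracProba y) ∂(Measure.dirac x)
      rw [integral_dirac]
    -- Split off the atom at `x`; the remainder, conditioned on `{x}ᶜ`, is supported in `F`.
    · have := ProbabilityTheory.cond_isProbabilityMeasure (μ := (p : Measure Ω)) h0
      let q : ProbabilityMeasure Ω := ⟨ProbabilityTheory.cond (p : Measure Ω) {x}ᶜ, this⟩
      have h0' : (p : Measure Ω).real {x}ᶜ ≠ 0 := by
        simpa [Measure.real, ENNReal.toReal_eq_zero_iff] using h0
      have hpq : p = mix t (diracProba x) q := by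
        refine ext_real fun s hs => ?_
        have hq : (q : Measure Ω).real s
            = ((p : Measure Ω).real {x}ᶜ)⁻¹ * (p : Measure Ω).real ({x}ᶜ ∩ s) := by
          change (ProbabilityTheory.cond (p : Measure Ω) {x}ᶜ).real s = _
          rw [Measure.real, ProbabilityTheory.cond_apply hxm.compl, ENNReal.toReal_mul,
            ENNReal.toReal_inv]
          rfl
        rw [mix_real, hq, hsplit s hs, ← ht, mul_inv_cancel_left₀ h0']
      have hq : φ q = ∫ x, φ (diracProba x) ∂(q : Measure Ω) := by
        apply ih
        change (ProbabilityTheory.cond (p : Measure Ω) {x}ᶜ) _ = 0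
        rw [ProbabilityTheory.cond_apply hxm.compl]
        convert mul_zero _
        refine measure_mono_null ?_ hp
        intro y
        simp
      rw [hpq, haff, hq, integral_mix _ _ _ (hint _) (hint _)]
      congr 2
      change _ = ∫ y, φ (diracProba y) ∂(Measure.dirac x)
      rw [integral_dirac]

/-- A continuous mixture-preserving functional is an expectation. -/
lemma eq_integral_of_continuous [MetricSpace Ω] [TopologicalSpace.SeparableSpace Ω] [BorelSpace Ω]
    {φ : ProbabilityMeasure Ω → ℝ} (hφ : Continuous φ)
    (haff : ∀ (s : I) p q, φ (mix s p q) = s * φ p + (1 - s) * φ q)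
    {C : ℝ} (hC : ∀ p, ‖φ p‖ ≤ C) (p : ProbabilityMeasure Ω) :
    φ p = ∫ x, φ (diracProba x) ∂(p : Measure Ω) := by
  have : Nonempty Ω := (p : Measure Ω).nonempty_of_neZero
  have hu : Continuous fun x : Ω => φ (diracProba x) := hφ.comp continuous_diracProba
  let u : BoundedContinuousFunction Ω ℝ := .ofNormedAddCommGroup _ hu C fun x => hC _
  obtain ⟨y⟩ := ‹Nonempty Ω›
  -- Simple functions approximating the identity push `p` forward to finitely supported lotteries
  -- converging weakly to `p`.
  let f (n : ℕ) := SimpleFunc.approxOn (id : Ω → Ω) measurable_id Set.univ y trivial n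
  let P (n : ℕ) : ProbabilityMeasure Ω := p.map (f n).measurable.aemeasurable
  have hf (x) : Tendsto (fun n => f n x) atTop (𝓝 x) :=
    SimpleFunc.tendsto_approxOn measurable_id _ (by simp)
  have hP : Tendsto P atTop (𝓝 p) := by
    refine ProbabilityMeasure.tendsto_iff_forall_integral_tendsto.2 fun g => ?_
    have (n : ℕ) : ∫ x, g x ∂(P n : Measure Ω) = ∫ x, g (f n x) ∂(p : Measure Ω) :=
      integral_map (f n).measurable.aemeasurable g.continuous.measurable.aestronglyMeasurable
    simp only [this]
    refine tendsto_integral_of_dominated_convergence (fun _ => ‖g‖)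
      (fun n => (g.continuous.measurable.comp (f n).measurable).aestronglyMeasurable)
      (integrable_const _) (fun n => ae_of_all _ fun x => g.norm_coe_le_norm _)
      (ae_of_all _ fun x => (g.continuous.tendsto x).comp (hf x))
  refine tendsto_nhds_unique ((hφ.tendsto p).comp hP) ?_
  refine (ProbabilityMeasure.tendsto_iff_forall_integral_tendsto.1 hP u).congr fun n => ?_
  refine (eq_integral_of_finite_support haff (fun p => u.integrable _) (f n).range (P n) ?_).symm
  change (p : Measure Ω).map (f n) _ = 0
  rw [Measure.map_apply (f n).measurable (Finset.measurableSet _).compl]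
  convert measure_empty (μ := (p : Measure Ω))
  ext x
  simp

/-- The expected utility theorem: a weakly continuous preference satisfying independence has a
Bernoulli index. -/
theorem exists_isBernoulliIndex [MetricSpace Ω] [TopologicalSpace.SeparableSpace Ω] [BorelSpace Ω]
    {pref : ProbabilityMeasure Ω → ProbabilityMeasure Ω → Prop} (hcomplete : IsComplete pref)
    (htrans : IsTransitive pref) (hcont : IsContinuous pref) (hindep : IsIndependent pref) :
    ∃ u : Ω → ℝ, IsBernoulliIndex pref u := by
  obtain ⟨φ, hφ, hrep, haff⟩ := exists_affine_representation hcomplete htrans hcont hindep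
  have hφ' : Continuous fun p => (φ p : ℝ) := continuous_subtype_val.comp hφ
  have hC (p) : ‖(φ p : ℝ)‖ ≤ 1 := by
    rw [Real.norm_of_nonneg (φ p).2.1]
    exact (φ p).2.2
  have hu : Continuous fun x : Ω => (φ (diracProba x) : ℝ) := hφ'.comp continuous_diracProba
  refine ⟨fun x => φ (diracProba x), hu, fun p => ?_, fun p q => ?_⟩
  · exact Integrable.of_bound hu.measurable.aestronglyMeasurable 1 (ae_of_all _ fun x => hC _)
  · rw [← eq_integral_of_continuous hφ' haff hC, ← eq_integral_of_continuous hφ' haff hC, hrep]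
    exact Iff.rfl

end ExpectedUtility

/-! ### Uniform lotteries on finite families. -/

section Average

variable {ι Ω Ω' : Type*} [Fintype ι] [Nonempty ι] [MeasurableSpace Ω] [MeasurableSpace Ω']

/-- The lottery drawing `f j` with `j` uniformly distributed. -/
def average (f : ι → Ω) : ProbabilityMeasure Ω :=
  ⟨(Fintype.card ι : ENNReal)⁻¹ • ∑ j, Measure.dirac (f j), by
    constructor
    simp [ENNReal.inv_mul_cancel]⟩

lemma average_comp_equiv (f : ι → Ω) (e : ι ≃ ι) : average (f ∘ e) = average f := by
  apply Subtype.ext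
  simp only [average, Function.comp_apply]
  rw [Equiv.sum_comp e fun j => Measure.dirac (f j)]

lemma map_average (f : ι → Ω) {g : Ω → Ω'} (hg : Measurable g) :
    (average f).map hg.aemeasurable = average (g ∘ f) := by
  apply Subtype.ext
  change Measure.map g ((Fintype.card ι : ENNReal)⁻¹ • ∑ j, Measure.dirac (f j))
    = (Fintype.card ι : ENNReal)⁻¹ • ∑ j, Measure.dirac (g (f j))
  rw [Measure.map_smul, ← Measure.mapₗ_apply_of_measurable hg, map_sum]
  simp [Measure.mapₗ_apply_of_measurable hg, Measure.map_dirac' hg]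

lemma integral_average {u : Ω → ℝ} (hu : Measurable u) (f : ι → Ω) :
    ∫ x, u x ∂(average f : Measure Ω) = (Fintype.card ι : ℝ)⁻¹ * ∑ j, u (f j) := by
  change ∫ x, u x ∂((Fintype.card ι : ENNReal)⁻¹ • ∑ j, Measure.dirac (f j)) = _
  rw [integral_smul_measure, integral_finsetSum_measure]
  · simp [integral_dirac' _ _ hu.stronglyMeasurable]
  · intro j _
    exact integrable_dirac' hu.stronglyMeasurable (by simp)

end Average

/-! ### The pairwise decomposition relative to a base profile. -/

section Profile

lemma map_pair_eq_of_marginal_eq {N : Type*} {S : N → Type*} [∀ j, MeasurableSpace (S j)]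
    {i j : N} {p q : ProbabilityMeasure (∀ j, S j)}
    (h : marginal {i, j} p = marginal {i, j} q) :
    (p : Measure (∀ j, S j)).map (fun s => (s i, s j))
      = (q : Measure (∀ j, S j)).map (fun s => (s i, s j)) := by
  have hr : Measurable fun (s : ∀ j, S j) (k : ({i, j} : Set N)) => s k :=
    measurable_pi_lambda _ fun k => measurable_pi_apply k.1
  have hg : Measurable fun r : ∀ k : ({i, j} : Set N), S k => (r ⟨i, by simp⟩, r ⟨j, by simp⟩) :=
    (measurable_pi_apply _).prodMk (measurable_pi_apply _)
  have h' : (p : Measure (∀ j, S j)).map (fun s (k : ({i, j} : Set N)) => s k)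
      = (q : Measure (∀ j, S j)).map (fun s (k : ({i, j} : Set N)) => s k) :=
    congrArg Subtype.val h
  have := congrArg (Measure.map fun r : ∀ k : ({i, j} : Set N), S k =>
    (r ⟨i, by simp⟩, r ⟨j, by simp⟩)) h'
  rwa [Measure.map_map hg hr, Measure.map_map hg hr] at this

variable {N : Type*} [DecidableEq N] {S : N → Type*}

/-- The profile that agrees with the base profile `o` except at `i` and `j`, where it takes the
values `x` and `y`. -/
def pinPair (o : ∀ j, S j) (i j : N) (x : S i) (y : S j) : ∀ k, S k :=
  Function.update (Function.update o i x) j y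

lemma pinPair_left (o : ∀ j, S j) {i j : N} (h : j ≠ i) (x : S i) (y : S j) :
    pinPair o i j x y i = x := by
  simp [pinPair, Function.update_of_ne h.symm]

lemma pinPair_right (o : ∀ j, S j) (i j : N) (x : S i) (y : S j) : pinPair o i j x y j = y := by
  simp [pinPair]

lemma pinPair_of_ne (o : ∀ j, S j) {i j k : N} (hi : k ≠ i) (hj : k ≠ j) (x : S i) (y : S j) :
    pinPair o i j x y k = o k := by
  simp [pinPair, Function.update_of_ne hi, Function.update_of_ne hj]

/-- The part of the pairwise decomposition of `u` relative to the base profile `o` that is due to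
the interaction of `i` with `j`, for `m` opponents. -/
def pairPart (u : (∀ j, S j) → ℝ) (o : ∀ j, S j) (i : N) (m : ℝ) (j : N) (z : S i × S j) : ℝ :=
  u (pinPair o i j z.1 z.2) - (m - 1) / m * u (Function.update o i z.1)

/-- The `m - 1` surplus copies of the value at `(s i, o)` are shared equally among the `m`
opponents. -/
lemma sum_pairPart [Fintype N] (u : (∀ j, S j) → ℝ) (o s : ∀ j, S j) (i : N)
    [Nonempty {j : N // j ≠ i}] :
    ∑ j : {j : N // j ≠ i}, pairPart u o i (Fintype.card {j : N // j ≠ i}) j (s i, s j)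
      = ∑ j : {j : N // j ≠ i}, u (pinPair o i j (s i) (s j))
        - (Fintype.card {j : N // j ≠ i} - 1) * u (Function.update o i (s i)) := by
  have : (Fintype.card {j : N // j ≠ i} : ℝ) ≠ 0 :=
    Nat.cast_ne_zero.2 Fintype.card_ne_zero
  simp only [pairPart, Finset.sum_sub_distrib, Finset.sum_const, Finset.card_univ, nsmul_eq_mul]
  field_simp


/-- A sum of functions of the pairs `(s i, s j)` is the sum of its pair parts. -/
lemma sum_pairPart_of_eq_sum [Fintype N] {i : N} (v : ∀ j : {j : N // j ≠ i}, S i × S j → ℝ)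
    (o s : ∀ j, S j) [Nonempty {j : N // j ≠ i}] :
    ∑ j : {j : N // j ≠ i}, pairPart (fun s => ∑ k : {j : N // j ≠ i}, v k (s i, s k)) o i
      (Fintype.card {j : N // j ≠ i}) j (s i, s j) = ∑ j : {j : N // j ≠ i}, v j (s i, s j) := by
  have h1 (j : {j : N // j ≠ i}) :
      ∑ k : {j : N // j ≠ i},
          v k (pinPair o i j (s i) (s j) i, pinPair o i j (s i) (s j) k)
        = ∑ k : {j : N // j ≠ i}, v k (s i, o k) + (v j (s i, s j) - v j (s i, o j)) := by
    have : ∑ k : {j : N // j ≠ i}, (if k = j then v j (s i, s j) - v j (s i, o j) else 0)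
        = v j (s i, s j) - v j (s i, o j) := by simp
    rw [← this, ← Finset.sum_add_distrib]
    refine Finset.sum_congr rfl fun k _ => ?_
    rw [pinPair_left o j.2]
    rcases eq_or_ne k j with rfl | hkj
    · rw [pinPair_right, if_pos rfl]
      ring
    · rw [pinPair_of_ne o k.2 (fun h => hkj (Subtype.ext h)), if_neg hkj, add_zero]
  have h2 : ∑ k : {j : N // j ≠ i}, v k (Function.update o i (s i) i, Function.update o i (s i) k)
      = ∑ k : {j : N // j ≠ i}, v k (s i, o k) :=
    Finset.sum_congr rfl fun k _ => by rw [Function.update_self, Function.update_of_ne k.2]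
  rw [sum_pairPart]
  simp only [h1, h2, Finset.sum_add_distrib, Finset.sum_const, Finset.card_univ, nsmul_eq_mul,
    Finset.sum_sub_distrib]
  ring

variable [∀ j, MetricSpace (S j)]

lemma continuous_pinPair (o : ∀ j, S j) (i j : N) :
    Continuous fun z : S i × S j => pinPair o i j z.1 z.2 :=
  (continuous_const.update i continuous_fst).update j continuous_snd

lemma continuous_pairPart {u : (∀ j, S j) → ℝ} (hu : Continuous u) (o : ∀ j, S j) (i : N) (m : ℝ)
    (j : N) : Continuous (pairPart u o i m j) :=
  (hu.comp (continuous_pinPair o i j)).sub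
    (continuous_const.mul (hu.comp (continuous_const.update i continuous_fst)))

variable [Fintype N] [∀ j, TopologicalSpace.SeparableSpace (S j)] [∀ j, MeasurableSpace (S j)]
  [∀ j, BorelSpace (S j)]

/-- Lotteries with the same marginals on every pair `{i, j}` give the same expectation to a
Bernoulli index that is a sum of functions of these pairs. -/
lemma IsBernoulliIndex.integral_eq {i : N}
    {pref : ProbabilityMeasure (∀ j, S j) → ProbabilityMeasure (∀ j, S j) → Prop}
    {v : ∀ j : {j : N // j ≠ i}, S i × S j → ℝ}
    (hv : IsBernoulliIndex pref fun s => ∑ j : {j : N // j ≠ i}, v j (s i, s j))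
    {p q : ProbabilityMeasure (∀ j, S j)}
    (hpq : ∀ j : N, j ≠ i → marginal {i, j} p = marginal {i, j} q) :
    ∫ s, ∑ j : {j : N // j ≠ i}, v j (s i, s j) ∂(p : Measure (∀ j, S j))
      = ∫ s, ∑ j : {j : N // j ≠ i}, v j (s i, s j) ∂(q : Measure (∀ j, S j)) := by
  rcases isEmpty_or_nonempty {j : N // j ≠ i} with _ | _
  · simp
  have hne : Nonempty (∀ j, S j) := (p : Measure (∀ j, S j)).nonempty_of_neZero
  obtain ⟨o⟩ := hne
  have : ∀ j, SecondCountableTopology (S j) := fun j =>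
    UniformSpace.secondCountable_of_separable (S j)
  set U : (∀ j, S j) → ℝ := fun s => ∑ k : {j : N // j ≠ i}, v k (s i, s k)
  -- Integrability under all lotteries includes push-forwards, so `U ∘ g` is integrable; each pair
  -- part combines two such compositions.
  have hcomp (r : ProbabilityMeasure (∀ j, S j)) {g : (∀ j, S j) → ∀ j, S j} (hg : Continuous g) :
      Integrable (fun s => U (g s)) (r : Measure (∀ j, S j)) :=
    (hv.integrable (r.map hg.measurable.aemeasurable)).comp_measurable hg.measurable
  have hint (r : ProbabilityMeasure (∀ j, S j)) (j : {j : N // j ≠ i}) :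
      Integrable (fun s => pairPart U o i (Fintype.card {j : N // j ≠ i}) j (s i, s j))
        (r : Measure (∀ j, S j)) :=
    (hcomp r ((continuous_pinPair o i j).comp
      ((continuous_apply i).prodMk (continuous_apply (j : N))))).sub
      ((hcomp r (continuous_const.update i (continuous_apply i))).const_mul _)
  have hsum (s) : U s
      = ∑ j : {j : N // j ≠ i}, pairPart U o i (Fintype.card {j : N // j ≠ i}) j (s i, s j) :=
    (sum_pairPart_of_eq_sum v o s).symm
  rw [integral_congr_ae (ae_of_all _ hsum), integral_congr_ae (ae_of_all _ hsum),
    integral_finsetSum _ fun j _ => hint p j, integral_finsetSum _ fun j _ => hint q j]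
  refine Finset.sum_congr rfl fun j _ => ?_
  have hm : Measurable fun s : ∀ j, S j => (s i, s (j : N)) :=
    (measurable_pi_apply _).prodMk (measurable_pi_apply _)
  have hc := (continuous_pairPart hv.continuous o i
    (Fintype.card {j : N // j ≠ i}) j).measurable
  rw [← integral_map hm.aemeasurable hc.aestronglyMeasurable,
    ← integral_map hm.aemeasurable hc.aestronglyMeasurable,
    map_pair_eq_of_marginal_eq (hpq j j.2)]

/-- If lotteries with the same marginals on every pair `{i, j}` are indifferent, then every
Bernoulli index is the sum of its pair parts. -/
lemma IsBernoulliIndex.eq_sum_pairPart {i : N} [Nonempty {j : N // j ≠ i}]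
    {pref : ProbabilityMeasure (∀ j, S j) → ProbabilityMeasure (∀ j, S j) → Prop}
    {u : (∀ j, S j) → ℝ} (hu : IsBernoulliIndex pref u)
    (h : ∀ p q : ProbabilityMeasure (∀ j, S j),
      (∀ j : N, j ≠ i → marginal {i, j} p = marginal {i, j} q) → Indifferent pref p q)
    (o s : ∀ j, S j) :
    u s = ∑ j : {j : N // j ≠ i},
      pairPart u o i (Fintype.card {j : N // j ≠ i}) j (s i, s j) := by
  let a : {j : N // j ≠ i} := Classical.arbitrary _
  let f (j : {j : N // j ≠ i}) : ∀ k, S k := if j = a then s else Function.update o i (s i)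
  let g (j : {j : N // j ≠ i}) : ∀ k, S k := pinPair o i j (s i) (s j)
  have hind := h (average f) (average g) fun k hk => by
    have hr : Measurable fun (s : ∀ j, S j) (l : ({i, k} : Set N)) => s l :=
      measurable_pi_lambda _ fun l => measurable_pi_apply l.1
    -- On `{i, k}`, the pair `(s i, s k)` occurs only at index `a` in `f` and at index `k` in `g`,
    -- up to coincidences of values; all other indices give `(s i, o k)`. Swapping `a` and `k`
    -- matches the families.
    rw [marginal, marginal, map_average f hr, map_average g hr,
      ← average_comp_equiv _ (Equiv.swap ⟨k, hk⟩ a)]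
    congr 1
    funext j
    have hj : Equiv.swap ⟨k, hk⟩ a j = a ↔ (j : N) = k := by
      rw [← Equiv.eq_symm_apply, Equiv.symm_swap, Equiv.swap_apply_right, Subtype.ext_iff]
    funext ⟨l, hl⟩
    change f (Equiv.swap ⟨k, hk⟩ a j) l = g j l
    simp only [f, g, hj]
    rcases hl with rfl | hl
    · rw [pinPair_left o j.2]
      split_ifs <;> simp
    · obtain rfl : l = k := hl
      split_ifs with hjl
      · subst hjl
        rw [pinPair_right]
      · rw [pinPair_of_ne o hk (Ne.symm hjl), Function.update_of_ne hk]
  have hum := hu.continuous.measurable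
  have heq := le_antisymm ((hu.represents _ _).1 hind.2) ((hu.represents _ _).1 hind.1)
  rw [integral_average hum, integral_average hum] at heq
  have hm : (Fintype.card {j : N // j ≠ i} : ℝ) ≠ 0 := Nat.cast_ne_zero.2 Fintype.card_ne_zero
  have heq := mul_left_cancel₀ (inv_ne_zero hm) heq
  have hf : ∑ j, u (f j)
      = u s + (Fintype.card {j : N // j ≠ i} - 1) * u (Function.update o i (s i)) := by
    have huf (j) : u (f j) = u (Function.update o i (s i))
        + if j = a then u s - u (Function.update o i (s i)) else 0 := by
      by_cases hj : j = a <;> simp [f, hj]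
    simp only [huf, Finset.sum_add_distrib, Finset.sum_const, Finset.card_univ, nsmul_eq_mul,
      Finset.sum_ite_eq', Finset.mem_univ, if_true]
    ring
  rw [sum_pairPart]
  linarith

end Profile

end Lottery

end

theorem mainTheorem9 {N : Type*} [Fintype N] [DecidableEq N] {S : N → Type*}
    [∀ j, MetricSpace (S j)] [∀ j, TopologicalSpace.SeparableSpace (S j)]
    [∀ j, MeasurableSpace (S j)] [∀ j, BorelSpace (S j)] (i : N)
    (pref : ProbabilityMeasure (∀ j, S j) → ProbabilityMeasure (∀ j, S j) → Prop)
    (hcomplete : Lottery.IsComplete pref) (htrans : Lottery.IsTransitive pref)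
    (hcont : Lottery.IsContinuous pref) (hindep : Lottery.IsIndependent pref) :
    (∃ u : ∀ j : {j : N // j ≠ i}, S i × S j → ℝ, (∀ j, Continuous (u j)) ∧
      Lottery.IsBernoulliIndex pref (fun s => ∑ j : {j : N // j ≠ i}, u j (s i, s j))) ↔
    ∀ p q : ProbabilityMeasure (∀ j, S j),
      (∀ j : N, j ≠ i → Lottery.marginal {i, j} p = Lottery.marginal {i, j} q) →
        Lottery.Indifferent pref p q := by
  constructor
  · rintro ⟨v, -, hv⟩ p q hpq
    have := hv.integral_eq hpq
    exact ⟨(hv.represents p q).2 this.ge, (hv.represents q p).2 this.le⟩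
  · intro h
    rcases isEmpty_or_nonempty (∀ j, S j) with hS | ⟨⟨o⟩⟩
    · have hP (p : ProbabilityMeasure (∀ j, S j)) : False :=
        hS.false (p : Measure (∀ j, S j)).nonempty_of_neZero.some
      exact ⟨fun _ _ => 0, fun _ => continuous_const, by simpa using continuous_const,
        fun p => (hP p).elim, fun p => (hP p).elim⟩
    -- Without opponents, (b) makes all lotteries indifferent, and the empty sum represents this;
    -- otherwise `m ≠ 0`, as the division by `m` requires.
    rcases isEmpty_or_nonempty {j : N // j ≠ i} with hN | _
    · have hpref (p q) : pref p q := (h p q fun j hj => (hN.false ⟨j, hj⟩).elim).1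
      exact ⟨fun _ _ => 0, fun _ => continuous_const, by simpa using continuous_const,
        fun p => by simp, fun p q => by simp [hpref]⟩
    obtain ⟨u, hu⟩ := Lottery.exists_isBernoulliIndex hcomplete htrans hcont hindep
    refine ⟨fun j => Lottery.pairPart u o i (Fintype.card {j : N // j ≠ i}) j,
      fun j => Lottery.continuous_pairPart hu.continuous o i _ j, ?_⟩
    rw [← funext fun s => hu.eq_sum_pairPart h o s]
    exact hu
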